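/- Let $q$ be a prime power and let $L, X, T$ be positive integers with $L$ even and $q \ge L+X+T+3$. Put $N = L+X+T+2$. An $X$-secure $T$-private information retrieval (XSTPIR) scheme over $\mathbb F_q$ for $K$ messages $s_1,\dots,s_K\in\mathbb F_q^L$ and $N$ servers ($X<N$, $1\le T\le N$) consists of a randomized storage map, which turns the messages into one share (a vector over $\mathbb F_q$) for each server; a randomized query map, which turns an index $\theta\in\{1,\dots,K\}$ into one query (a vector over $\mathbb F_q$) for each server, independently of the storage; and answer maps, by which each server computes from its share and its query a vector over $\mathbb F_q$; such that - (correctness) $s_\theta$ is always determined by the $N$ answers; - ($X$-security) the joint distribution of the shares of any at most $X$ servers does not depend on $s_1,\dots,s_K$; - ($T$-privacy) for all fixed messages, the joint distribution of the shares and queries of any at most $T$ servers does not depend on $\theta$. Its rate is $L$ divided by the total number of symbols of $\mathbb F_q$ in the $N$ answers. Then for every number $K$ of messages there is an XSTPIR scheme over $\mathbb F_q$ with $N$ servers and rate $$\frac{L}{N}=\frac{L}{L+X+T+2}.$$ More precisely, there exist $L/2$ distinct monic irreducible quadratic polynomials in $\mathbb F_q[x]$, and for any such $f_1,\dots,f_{L/2}$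 put $h_{2a-1}=1/f_a$ and $h_{2a}=x/f_a$ for $1\le a\le L/2$. Then there are distinct nonzero points $\alpha_1,\dots,\alpha_N\in\mathbb F_q$ such that, for every $K$, the following scheme is an XSTPIR scheme with the above rate. For $\ell\in\{1,\dots,L\}$ and $k\in\{1,\dots,K\}$ choose polynomials $r_{\ell,k}$ of degree less than $X$ and $z_{\ell,k}$ of degree less than $T$ over $\mathbb F_q$, independently and uniformly at random. Server $n$ stores $S_{n,\ell,k}=(s_k)_\ell+h_\ell(\alpha_n)^{-1}r_{\ell,k}(\alpha_n)$, receives the query $Q_{n,\ell,k}=\delta_{k,\theta}\,h_\ell(\alpha_n)+z_{\ell,k}(\alpha_n)$ and answers with the single symbol $\sum_{\ell,k}S_{n,\ell,k}Q_{n,\ell,k}$. -/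

import Mathlib

open Polynomial

noncomputable section

/-- A storage scheme with a private information retrieval scheme on top of it, over the field `F`:
`K` messages in `F ^ L`, held by `N` servers.  Shares, queries and answers are vectors over `F`
(indexed by finite types; the answer of server `n` has `answerLen n` entries).
The user produces the queries knowing only the desired index: the shares and the queries are
drawn independently of each other. Each answer is a function of the share and the query of the
answering server. -/
structure PIRScheme (F : Type*) (K L N : ℕ) where
  ShareIndex : Fin N → Type
  QueryIndex : Fin N → Type
  answerLen : Fin N → ℕ
  shareFinite : ∀ n, Finite (ShareIndex n)
  queryFinite : ∀ n, Finite (QueryIndex n)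
  /-- the joint law of all shares, given the messages -/
  storage : (Fin K → Fin L → F) → PMF (∀ n, ShareIndex n → F)
  /-- the joint law of all queries, given the index of the desired message -/
  query : Fin K → PMF (∀ n, QueryIndex n → F)
  /-- the answer of each server -/
  answer : ∀ n, (ShareIndex n → F) → (QueryIndex n → F) → (Fin (answerLen n) → F)

namespace PIRScheme

variable {F : Type*} {K L N : ℕ}

/-- The desired message can always be recovered precisely from all the answers. -/
def IsCorrect (S : PIRScheme F K L N) : Prop :=
  ∃ decode : (∀ n, Fin (S.answerLen n) → F) → (Fin L → F),
    ∀ (s : Fin K → Fin L → F) (θ : Fin K),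
      ∀ σ ∈ (S.storage s).support, ∀ κ ∈ (S.query θ).support,
        decode (fun n => S.answer n (σ n) (κ n)) = s θ

/-- Any (at most) `X` colluding servers learn nothing about the messages: the joint law of their
shares does not depend on the messages. -/
def IsSecure (S : PIRScheme F K L N) (X : ℕ) : Prop :=
  ∀ C : Finset (Fin N), C.card ≤ X → ∀ s s' : Fin K → Fin L → F,
    (S.storage s).map C.restrict = (S.storage s').map C.restrict

/-- The joint law of all that the servers in `C` see (their shares and their queries, which also
determine their answers) when the messages are `s` and the desired index is `θ`. -/
def view (S : PIRScheme F K L N) (C : Finset (Fin N)) (s : Fin K → Fin L → F) (θ : Fin K) :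
    PMF ((∀ n : C, S.ShareIndex n → F) × (∀ n : C, S.QueryIndex n → F)) :=
  (S.storage s).bind fun σ => (S.query θ).map fun κ => (C.restrict σ, C.restrict κ)

/-- Any (at most) `T` colluding servers learn nothing about the index of the desired message:
whatever the messages are, the joint law of what they see does not depend on the index. -/
def IsPrivate (S : PIRScheme F K L N) (T : ℕ) : Prop :=
  ∀ C : Finset (Fin N), C.card ≤ T → ∀ (s : Fin K → Fin L → F) (θ θ' : Fin K),
    S.view C s θ = S.view C s θ'

/-- `X`-secure and `T`-private information retrieval scheme. -/
structure IsXSTPIR (S : PIRScheme F K L N) (X T : ℕ) : Prop where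
  X_lt : X < N
  one_le_T : 1 ≤ T
  T_le : T ≤ N
  correct : S.IsCorrect
  secure : S.IsSecure X
  isPrivate : S.IsPrivate T

/-- The PIR rate: file size divided by total download, both counted in symbols of `F`. -/
def rate (S : PIRScheme F K L N) : ℚ :=
  (L : ℚ) / ((∑ n, S.answerLen n : ℕ) : ℚ)

end PIRScheme

/-- For `a = 0, …, L / 2 - 1` the functions number `2 a` and `2 a + 1` are `1 / f a` and
`x / f a`. -/
def queryFunction {F : Type*} [Field F] {L : ℕ} (hL : 2 ∣ L) (f : Fin (L / 2) → F[X])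
    (l : Fin L) : RatFunc F :=
  RatFunc.X ^ (l.val % 2) / algebraMap F[X] (RatFunc F) (f ⟨l.val / 2, by omega⟩)

/-- The value at the point `a` of a rational function that is regular there. -/
def valueAt {F : Type*} [Field F] (a : F) (g : RatFunc F) : F :=
  g.eval (RingHom.id F) a

/-- The scheme with query functions `h 0, …, h (L - 1)` and evaluation points `α n`.

* Entry `(l, k)` of the share of server `n` is `s k l + (h l)⁻¹ (α n) * r (α n)`,
  where `r` is a uniformly random polynomial of degree `< X`, one for each `(l, k)`.
* Entry `(l, k)` of the query to server `n` is `δ * h l (α n) + z (α n)`,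
  where `δ` is `1` for `k = θ` and `0` otherwise, and `z` is a uniformly random polynomial of
  degree `< T`, one for each `(l, k)`.
* The answer is the single symbol given by the inner product of the share and the query. -/
def evaluationScheme {F : Type*} [Field F] [Fintype F] {L N : ℕ} (K X T : ℕ)
    (h : Fin L → RatFunc F) (α : Fin N → F) : PIRScheme F K L N where
  ShareIndex _ := Fin L × Fin K
  QueryIndex _ := Fin L × Fin K
  answerLen _ := 1
  shareFinite _ := inferInstance
  queryFinite _ := inferInstance
  storage s :=
    (PMF.uniformOfFintype (Fin L × Fin K → Fin X → F)).map fun r n e =>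
      s e.2 e.1 + valueAt (α n) (h e.1)⁻¹ * ∑ i : Fin X, r e i * α n ^ (i : ℕ)
  query θ :=
    (PMF.uniformOfFintype (Fin L × Fin K → Fin T → F)).map fun z n e =>
      (if e.2 = θ then valueAt (α n) (h e.1) else 0) + ∑ j : Fin T, z e j * α n ^ (j : ℕ)
  answer _ σ κ := fun _ => ∑ e, σ e * κ e

end

/-! In `(s + h⁻¹ r) (δ h + z)` the desired term is `δ s h`; the noise is `s z + δ r + h⁻¹ r z`.
Since `h⁻¹` is `f` or `f / x`, multiplying by `x` turns the noise into a polynomial of degree at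
most `X + T + 1` (`exists_answer_eq`). There remain `L` coefficients of the functions `x h` and `X +
T + 2` polynomial coefficients, as many unknowns as servers. By partial fractions, the message
coefficients are determined by the values at `N` distinct points
(`eq_zero_of_sum_queryFunction_add_eval_eq_zero`).

Security and privacy are Shamir secret sharing (`map_restrict_uniform_shares_eq`); the mask factor
`h⁻¹` does not vanish at nonzero points, because an irreducible quadratic has no root. -/

/-! ### Values and linear independence of the query functions -/

theorem valueAt_algebraMap_div {F : Type*} [Field F] (a : F) (p g : F[X]) (hg : g.eval a ≠ 0) :
    valueAt a (algebraMap F[X] (RatFunc F) p / algebraMap F[X] (RatFunc F) g)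
      = p.eval a / g.eval a := by
  have hg0 : g ≠ 0 := by
    rintro rfl
    simp at hg
  set x := algebraMap F[X] (RatFunc F) p / algebraMap F[X] (RatFunc F) g with hx
  -- Evaluation uses the reduced fraction, which cross-multiplication compares with `p / g`.
  have hcross : x.num * g = p * x.denom := (RatFunc.num_mul_eq_mul_denom_iff hg0).2 hx
  have hden : x.denom.eval a ≠ 0 := fun h0 =>
    hg (eval_eq_zero_of_dvd_of_eval_eq_zero (RatFunc.denom_div_dvd p g) h0)
  have hev := congrArg (eval a) hcross
  rw [eval_mul, eval_mul] at hev
  change (x.num.eval₂ (RingHom.id F) a) / (x.denom.eval₂ (RingHom.id F) a) = _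
  rw [eval₂_id, eval₂_id, div_eq_div_iff hden hg, hev]

theorem Polynomial.eval_ne_zero_of_irreducible_of_one_lt_natDegree {F : Type*} [Field F]
    {p : F[X]} (hp : Irreducible p) (hd : 1 < p.natDegree) (a : F) : p.eval a ≠ 0 := by
  intro h0
  have h1 := degree_eq_one_of_irreducible_of_root hp h0
  have h2 := natDegree_eq_of_degree_eq_some h1
  exact hd.ne' h2

section QueryFunction

variable {F : Type*} [Field F] {L : ℕ} (hL : 2 ∣ L) (f : Fin (L / 2) → F[X])

/-- The index of the quadratic polynomial in the denominator of the `l`-th query function. -/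
def halfIndex (l : Fin L) : Fin (L / 2) := ⟨l.val / 2, by omega⟩

theorem valueAt_queryFunction (a : F) (l : Fin L) (hf : (f (halfIndex hL l)).eval a ≠ 0) :
    valueAt a (queryFunction hL f l) = a ^ (l.val % 2) / (f (halfIndex hL l)).eval a := by
  have h := valueAt_algebraMap_div a (X ^ (l.val % 2)) (f (halfIndex hL l)) hf
  simpa [queryFunction, halfIndex] using h

theorem valueAt_queryFunction_inv (a : F) (ha : a ≠ 0) (l : Fin L) :
    valueAt a (queryFunction hL f l)⁻¹ = (f (halfIndex hL l)).eval a / a ^ (l.val % 2) := by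
  have h := valueAt_algebraMap_div a (f (halfIndex hL l)) (X ^ (l.val % 2)) (by simp [ha])
  simpa [queryFunction, halfIndex] using h

/-- The functions `x * h l` together with the polynomials of degree less than `M` are linearly
independent when evaluated at `L + M` distinct points. -/
theorem eq_zero_of_sum_queryFunction_add_eval_eq_zero
    (hf : Function.Injective f)
    (hirr : ∀ a, (f a).Monic ∧ Irreducible (f a) ∧ (f a).natDegree = 2)
    {M : ℕ} (hM : 0 < M) {α : Fin (L + M) → F} (hα : Function.Injective α)
    (c : Fin L → F) (P : F[X]) (hP : P.natDegree < M)
    (h0 : ∀ n, ∑ l, c l * (α n * valueAt (α n) (queryFunction hL f l)) + P.eval (α n) = 0) :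
    c = 0 := by
  classical
  have hne : ∀ a b, (f a).eval b ≠ 0 := fun a b =>
    eval_ne_zero_of_irreducible_of_one_lt_natDegree (hirr a).2.1 (by rw [(hirr a).2.2]; omega) b
  set cof : Fin (L / 2) → F[X] := fun a => ∏ b ∈ Finset.univ.erase a, f b with hcof
  have hcofmul : ∀ a, f a * cof a = ∏ b, f b := fun a =>
    Finset.mul_prod_erase _ _ (Finset.mem_univ a)
  have hdprod : (∏ b, f b).natDegree = L := by
    rw [natDegree_prod_of_monic _ _ fun i _ => (hirr i).1]
    simp [(hirr _).2.2]
    omega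
  have hdcof : ∀ a, (cof a).natDegree + 2 = L := fun a => by
    rw [← hdprod, ← hcofmul a, (hirr a).1.natDegree_mul', (hirr a).2.2, add_comm]
    exact (monic_prod_of_monic _ _ fun i _ => (hirr i).1).ne_zero
  -- The vanishing combination times `∏ b, f b`. Its first part has degree at most `2 + (L - 2) =
  -- L`, which is below `L + M` because `0 < M`.
  set H : F[X] := ∑ l, C (c l) * X ^ (l.val % 2 + 1) * cof (halfIndex hL l) + P * ∏ b, f b with hH
  have hHdeg : H.natDegree < L + M := by
    refine (natDegree_add_le _ _).trans_lt (max_lt ?_ ?_)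
    · refine lt_of_le_of_lt (natDegree_sum_le_of_forall_le (n := L) _ _ fun l _ => ?_) (by omega)
      refine natDegree_mul_le.trans ?_
      have h1 := natDegree_C_mul_X_pow_le (c l) (l.val % 2 + 1)
      have h2 := hdcof (halfIndex hL l)
      omega
    · refine natDegree_mul_le.trans_lt ?_
      omega
  have hH0 : H = 0 := by
    refine eq_zero_of_natDegree_lt_card_of_eval_eq_zero H hα (fun n => ?_) (by simpa using hHdeg)
    have key : H.eval (α n) = (∏ b, f b).eval (α n) *
        (∑ l, c l * (α n * valueAt (α n) (queryFunction hL f l)) + P.eval (α n)) := by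
      rw [hH, mul_add, Finset.mul_sum, eval_add, eval_finsetSum, eval_mul, mul_comm (eval _ P)]
      congr 1
      refine Finset.sum_congr rfl fun l _ => ?_
      rw [valueAt_queryFunction hL f _ _ (hne _ _), ← hcofmul (halfIndex hL l)]
      have := hne (halfIndex hL l) (α n)
      simp only [eval_mul, eval_C, eval_pow, eval_X]
      field_simp
      ring
    rw [key, h0, mul_zero]
  have hdvd : ∀ a b, a ≠ b → f a ∣ cof b := fun a b hab =>
    Finset.dvd_prod_of_mem _ (Finset.mem_erase.2 ⟨hab, Finset.mem_univ _⟩)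
  have hndvd : ∀ a, ¬ f a ∣ cof a := by
    intro a hd
    obtain ⟨b, hb, hab⟩ := ((hirr a).2.1.prime.dvd_finsetProd_iff _).1 hd
    have := eq_of_monic_of_associated (hirr a).1 (hirr b).1
      ((hirr a).2.1.associated_of_dvd (hirr b).2.1 hab)
    exact (Finset.ne_of_mem_erase hb) (hf this).symm
  funext l
  set a := halfIndex hL l with ha
  -- The two coefficients over the same denominator `f a`. Modulo `f a` only they survive in `H`,
  -- and `f a` divides neither `X` nor `cof a`, so it divides `Q`, whose degree is too small.
  set Q : F[X] := ∑ j with halfIndex hL j = a, C (c j) * X ^ (j.val % 2) with hQ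
  have hQdeg : Q.natDegree ≤ 1 :=
    natDegree_sum_le_of_forall_le _ _ fun j _ =>
      (natDegree_C_mul_X_pow_le _ _).trans (by omega)
  have hQdvd : f a ∣ X * Q * cof a := by
    have hsplit : H = X * Q * cof a +
        (∑ j with ¬ halfIndex hL j = a, C (c j) * X ^ (j.val % 2 + 1) * cof (halfIndex hL j)
          + P * ∏ b, f b) := by
      rw [hH, ← add_assoc]
      congr 1
      rw [← Finset.sum_filter_add_sum_filter_not Finset.univ (fun j => halfIndex hL j = a)]
      congr 1
      rw [hQ, Finset.mul_sum, Finset.sum_mul]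
      refine Finset.sum_congr rfl fun j hj => ?_
      rw [(Finset.mem_filter.1 hj).2]
      ring
    have hrest : f a ∣ ∑ j with ¬ halfIndex hL j = a,
        C (c j) * X ^ (j.val % 2 + 1) * cof (halfIndex hL j) + P * ∏ b, f b := by
      refine dvd_add (Finset.dvd_sum fun j hj => ?_) ?_
      · exact Dvd.dvd.mul_left (hdvd _ _ (Ne.symm (Finset.mem_filter.1 hj).2)) _
      · exact Dvd.dvd.mul_left (Finset.dvd_prod_of_mem _ (Finset.mem_univ a)) _
    refine (dvd_add_left hrest).1 ?_
    rw [← hsplit, hH0]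
    exact dvd_zero _
  have hprime := (hirr a).2.1.prime
  have hQ0 : Q = 0 := by
    rcases hprime.dvd_or_dvd hQdvd with h | h
    · rcases hprime.dvd_or_dvd h with h | h
      · have := natDegree_le_of_dvd h X_ne_zero
        rw [(hirr a).2.2, natDegree_X] at this
        omega
      · by_contra hne
        have := natDegree_le_of_dvd h hne
        rw [(hirr a).2.2] at this
        omega
    · exact absurd h (hndvd a)
  have hcoeff : Q.coeff (l.val % 2) = c l := by
    rw [hQ, finsetSum_coeff, Finset.sum_eq_single l]
    · simp
    · intro j hj hjl
      have h1 : j.val / 2 = l.val / 2 := congrArg Fin.val (Finset.mem_filter.1 hj).2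
      rw [coeff_C_mul_X_pow, if_neg]
      intro h2
      exact hjl (Fin.ext (by omega))
    · intro h
      simp [ha] at h
  rw [← hcoeff, hQ0]
  simp

end QueryFunction

/-! ### Shape of the answers -/

theorem natDegree_sum_C_mul_X_pow_lt {R : Type*} [Semiring R] {m : ℕ} (hm : 0 < m)
    (r : Fin m → R) : (∑ i, C (r i) * X ^ (i : ℕ)).natDegree < m := by
  refine lt_of_le_of_lt (natDegree_sum_le_of_forall_le (n := m - 1) _ _ fun i _ => ?_) (by omega)
  exact (natDegree_C_mul_X_pow_le _ _).trans (by omega)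

/-- The answer of a server at the point `a`, multiplied by `a`, is the value of a combination of
the functions `x * h l` with the entries of the desired message as coefficients, plus the value of
a polynomial of degree less than `X + T + 2` that depends only on the randomness and the
messages. -/
theorem exists_answer_eq {F : Type*} [Field F] {K L x t : ℕ} (hL : 2 ∣ L)
    (hx : 0 < x) (ht : 0 < t) (f : Fin (L / 2) → F[X])
    (hirr : ∀ a, (f a).Monic ∧ Irreducible (f a) ∧ (f a).natDegree = 2)
    (s : Fin K → Fin L → F) (θ : Fin K) (r : Fin L × Fin K → Fin x → F)
    (z : Fin L × Fin K → Fin t → F) :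
    ∃ P : F[X], P.natDegree < x + t + 2 ∧ ∀ a : F, a ≠ 0 →
      a * ∑ e : Fin L × Fin K,
        (s e.2 e.1 + valueAt a (queryFunction hL f e.1)⁻¹ * ∑ i, r e i * a ^ (i : ℕ)) *
        ((if e.2 = θ then valueAt a (queryFunction hL f e.1) else 0) + ∑ j, z e j * a ^ (j : ℕ))
      = ∑ l, s θ l * (a * valueAt a (queryFunction hL f l)) + P.eval a := by
  set R : Fin L × Fin K → F[X] := fun e => ∑ i, C (r e i) * X ^ (i : ℕ) with hR
  set Z : Fin L × Fin K → F[X] := fun e => ∑ j, C (z e j) * X ^ (j : ℕ) with hZ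
  have hRd : ∀ e, (R e).natDegree < x := fun e => natDegree_sum_C_mul_X_pow_lt hx _
  have hZd : ∀ e, (Z e).natDegree < t := fun e => natDegree_sum_C_mul_X_pow_lt ht _
  have hRe : ∀ e a, (R e).eval a = ∑ i, r e i * a ^ (i : ℕ) := fun e a => by
    simp [hR, eval_finsetSum]
  have hZe : ∀ e a, (Z e).eval a = ∑ j, z e j * a ^ (j : ℕ) := fun e a => by
    simp [hZ, eval_finsetSum]
  -- The noise terms times `x`, where `x h⁻¹ = X ^ (1 - l % 2) * f`. The last one dominates: `1 + 2
  -- + (x - 1) + (t - 1) = x + t + 1`.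
  refine ⟨∑ e, (C (s e.2 e.1) * X * Z e + (if e.2 = θ then X * R e else 0)
    + X ^ (1 - e.1.val % 2) * f (halfIndex hL e.1) * R e * Z e), ?_, fun a ha => ?_⟩
  · refine lt_of_le_of_lt (natDegree_sum_le_of_forall_le (n := x + t + 1) _ _ fun e _ => ?_)
      (by omega)
    have h1 := hRd e
    have h2 := hZd e
    refine (natDegree_add_le _ _).trans (max_le ((natDegree_add_le _ _).trans (max_le ?_ ?_)) ?_)
    · refine natDegree_mul_le.trans ?_
      have := natDegree_C_mul_le (s e.2 e.1) X
      rw [natDegree_X] at this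
      omega
    · split_ifs
      · refine natDegree_mul_le.trans ?_
        rw [natDegree_X]
        omega
      · simp
    · refine natDegree_mul_le.trans ?_
      have h3 := natDegree_mul_le (p := X ^ (1 - e.1.val % 2) * f (halfIndex hL e.1)) (q := R e)
      have h4 := natDegree_mul_le (p := (X : F[X]) ^ (1 - e.1.val % 2)) (q := f (halfIndex hL e.1))
      rw [(hirr _).2.2, natDegree_X_pow] at h4
      omega
  · have hdelta : ∑ l, s θ l * (a * valueAt a (queryFunction hL f l))
        = ∑ e : Fin L × Fin K,
          if e.2 = θ then s e.2 e.1 * (a * valueAt a (queryFunction hL f e.1)) else 0 := by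
      rw [Fintype.sum_prod_type]
      exact Finset.sum_congr rfl fun l _ => by simp
    rw [hdelta, eval_finsetSum, ← Finset.sum_add_distrib, Finset.mul_sum]
    refine Finset.sum_congr rfl fun e _ => ?_
    have hfe : (f (halfIndex hL e.1)).eval a ≠ 0 :=
      eval_ne_zero_of_irreducible_of_one_lt_natDegree (hirr _).2.1
        (by rw [(hirr _).2.2]; omega) a
    rw [← hRe, ← hZe, valueAt_queryFunction hL f _ _ hfe, valueAt_queryFunction_inv hL f _ ha]
    have hpow : a ^ (1 - e.1.val % 2) * a ^ (e.1.val % 2) = a := by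
      rw [← pow_add, Nat.sub_add_cancel (by omega), pow_one]
    have hpa : a ^ (e.1.val % 2) ≠ 0 := pow_ne_zero _ ha
    have hpow' : a ^ (1 - e.1.val % 2) = a / a ^ (e.1.val % 2) := by
      rw [eq_div_iff hpa, hpow]
    split_ifs
    · simp only [eval_add, eval_mul, eval_C, eval_X, eval_pow, hpow']
      field_simp
      ring
    · simp only [eval_add, eval_mul, eval_C, eval_X, eval_pow, hpow', eval_zero]
      field_simp
      ring

/-! ### Shamir secret sharing -/

theorem PMF.map_uniformOfFintype_equiv {A : Type*} [Fintype A] [Nonempty A] (e : A ≃ A) :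
    (PMF.uniformOfFintype A).map e = PMF.uniformOfFintype A := by
  classical
  ext b
  rw [PMF.map_apply, tsum_eq_single (e.symm b)]
  · simp
  · intro a ha
    rw [if_neg]
    rintro rfl
    simp at ha

theorem PMF.map_uniformOfFintype_eq_of_add_right {A B : Type*} [AddGroup A] [Fintype A]
    {g g' : A → B} (d : A) (h : ∀ a, g (a + d) = g' a) :
    (PMF.uniformOfFintype A).map g = (PMF.uniformOfFintype A).map g' := by
  conv_lhs => rw [← PMF.map_uniformOfFintype_equiv (Equiv.addRight d), PMF.map_comp]
  congr 1
  funext a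
  exact h a

theorem exists_sum_mul_pow_eq {F ι : Type*} [Field F] {m : ℕ} (hm : 0 < m)
    {α : ι → F} (hα : Function.Injective α) (C : Finset ι) (hC : C.card ≤ m) (v : ι → F) :
    ∃ d : Fin m → F, ∀ n ∈ C, ∑ i, d i * α n ^ (i : ℕ) = v n := by
  classical
  set p := Lagrange.interpolate C α v with hp
  have hdeg : p.natDegree < m := by
    by_cases h0 : p = 0
    · simpa [h0] using hm
    · rw [natDegree_lt_iff_degree_lt h0]
      exact (Lagrange.degree_interpolate_lt v hα.injOn).trans_le (by exact_mod_cast hC)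
  refine ⟨fun i => p.coeff i, fun n hn => ?_⟩
  rw [Fin.sum_univ_eq_sum_range (fun i => p.coeff i * α n ^ i) m, ← eval_eq_sum_range' hdeg]
  exact Lagrange.eval_interpolate_at_node v hα.injOn hn

/-- Shamir secret sharing: scaled shares of at most `m` servers at distinct points, masked by
random polynomials of degree less than `m`, have the same law for all secrets. -/
theorem map_restrict_uniform_shares_eq {F ι E : Type*} [Field F] [Fintype F] [Fintype E] [DecidableEq E]
    {m : ℕ} (hm : 0 < m) {α : ι → F} (hα : Function.Injective α) (C : Finset ι)
    (hC : C.card ≤ m) (w : ι → E → F) (hw : ∀ n e, w n e ≠ 0) (u u' : ι → E → F) :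
    ((PMF.uniformOfFintype (E → Fin m → F)).map fun r n e =>
        u n e + w n e * ∑ i : Fin m, r e i * α n ^ (i : ℕ)).map C.restrict
      = ((PMF.uniformOfFintype (E → Fin m → F)).map fun r n e =>
        u' n e + w n e * ∑ i : Fin m, r e i * α n ^ (i : ℕ)).map C.restrict := by
  -- Lagrange interpolation gives a shift of the mask that absorbs the change of secret on `C`; the
  -- uniform law is invariant under this shift.
  choose d hd using fun e =>
    exists_sum_mul_pow_eq hm hα C hC fun n => (u' n e - u n e) / w n e
  rw [PMF.map_comp, PMF.map_comp]
  refine PMF.map_uniformOfFintype_eq_of_add_right d fun r => ?_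
  funext n e
  have hwe := hw n e
  simp only [Function.comp_apply, Finset.restrict, Pi.add_apply, add_mul, Finset.sum_add_distrib]
  rw [hd e n n.2]
  field_simp
  ring

/-! ### Counting irreducible quadratics -/

theorem Polynomial.monic_quadratic {R : Type*} [Semiring R] (b c : R) :
    (X ^ 2 + C b * X + C c).Monic := by
  nontriviality R
  monicity!

theorem Polynomial.natDegree_monic_quadratic {R : Type*} [Semiring R] [Nontrivial R] (b c : R) :
    (X ^ 2 + C b * X + C c).natDegree = 2 := by
  compute_degree!

/-- A reducible monic quadratic splits, so it comes from an unordered pair of roots. -/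
theorem card_not_irreducible_quadratic_le (F : Type*) [Field F] [Fintype F] :
    ({b : F × F | ¬ Irreducible (X ^ 2 + C b.1 * X + C b.2)} : Set (F × F)).ncard
      ≤ (Fintype.card F + 1).choose 2 := by
  classical
  let φ : Sym2 F → F × F :=
    Sym2.lift ⟨fun u v => (-(u + v), u * v), fun u v => by simp [add_comm, mul_comm]⟩
  have hsub : {b : F × F | ¬ Irreducible (X ^ 2 + C b.1 * X + C b.2)} ⊆ Set.range φ := by
    rintro ⟨b, c⟩ hbc
    rw [Set.mem_ofPred_eq, (monic_quadratic b c).irreducible_iff_roots_eq_zero_of_degree_le_three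
      (by rw [natDegree_monic_quadratic]) (by rw [natDegree_monic_quadratic]; omega)] at hbc
    obtain ⟨u, hu⟩ := Multiset.exists_mem_of_ne_zero hbc
    have hroot := isRoot_of_mem_roots hu
    simp only [IsRoot, eval_add, eval_mul, eval_pow, eval_X, eval_C] at hroot
    -- The second root, by Vieta.
    refine ⟨s(u, -b - u), ?_⟩
    simp only [φ, Sym2.lift_mk, Prod.mk.injEq]
    constructor
    · ring
    · linear_combination -hroot
  calc _ ≤ (Set.range φ).ncard := Set.ncard_le_ncard hsub (Set.toFinite _)
    _ ≤ Nat.card (Sym2 F) := by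
      rw [← Set.image_univ, ← Set.ncard_univ]
      exact Set.ncard_image_le (Set.toFinite _)
    _ = _ := by rw [Nat.card_eq_fintype_card, Sym2.card]

theorem exists_injective_monic_irreducible_quadratic (F : Type*) [Field F] [Fintype F] {m : ℕ}
    (hm : m ≤ (Fintype.card F).choose 2) :
    ∃ f : Fin m → F[X], Function.Injective f ∧
      ∀ a, (f a).Monic ∧ Irreducible (f a) ∧ (f a).natDegree = 2 := by
  classical
  set B : Set (F × F) := {b | ¬ Irreducible (X ^ 2 + C b.1 * X + C b.2)} with hB
  have hcard : m ≤ Nat.card (Bᶜ : Set (F × F)) := by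
    have h1 : B.ncard ≤ _ := card_not_irreducible_quadratic_le F
    have h2 := Set.ncard_add_ncard_compl B
    rw [Nat.card_prod, Nat.card_eq_fintype_card] at h2
    rw [Nat.card_coe_set_eq]
    have h3 : (Fintype.card F + 1).choose 2 = Fintype.card F + (Fintype.card F).choose 2 := by
      rw [Nat.choose_succ_succ' _ 1, Nat.choose_one_right]
    have h5 : 2 * (Fintype.card F).choose 2 + Fintype.card F
        = Fintype.card F * Fintype.card F := by
      have h6 := Nat.choose_two_right (Fintype.card F)
      have h7 := Nat.div_mul_cancel (Nat.even_mul_pred_self (Fintype.card F)).two_dvd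
      rw [← h6] at h7
      have hpos : 0 < Fintype.card F := Fintype.card_pos
      obtain ⟨k, hk⟩ := Nat.exists_eq_succ_of_ne_zero hpos.ne'
      rw [hk] at h7 ⊢
      simp only [Nat.succ_eq_add_one, Nat.add_sub_cancel] at h7 ⊢
      linarith [mul_add (k + 1) k 1]
    omega
  have : Fintype (Bᶜ : Set (F × F)) := Fintype.ofFinite _
  obtain ⟨g⟩ : Nonempty (Fin m ↪ (Bᶜ : Set (F × F))) := by
    rw [Function.Embedding.nonempty_iff_card_le, Fintype.card_fin, ← Nat.card_eq_fintype_card]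
    exact hcard
  refine ⟨fun a => X ^ 2 + C (g a).1.1 * X + C (g a).1.2, fun a a' haa => ?_, fun a => ⟨?_, ?_, ?_⟩⟩
  · have h0 := congrArg (fun p : F[X] => p.coeff 0) haa
    have h1 := congrArg (fun p : F[X] => p.coeff 1) haa
    simp [coeff_X_pow, coeff_C] at h0 h1
    exact g.injective (Subtype.ext (Prod.ext h1 h0))
  · exact monic_quadratic _ _
  · exact not_not.1 (g a).2
  · exact natDegree_monic_quadratic _ _

/-! ### Security, privacy, correctness and rate -/

section EvaluationScheme

variable {F : Type*} [Field F] [Fintype F] {K L x t N : ℕ}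

theorem evaluationScheme_isSecure {h : Fin L → RatFunc F} {α : Fin N → F} (hx : 0 < x)
    (hα : Function.Injective α) (hw : ∀ n l, valueAt (α n) (h l)⁻¹ ≠ 0) :
    (evaluationScheme K x t h α).IsSecure x := fun C hC s s' =>
  map_restrict_uniform_shares_eq hx hα C hC
    (fun n (e : Fin L × Fin K) => valueAt (α n) (h e.1)⁻¹) (fun n e => hw n e.1)
    (fun _ e => s e.2 e.1) (fun _ e => s' e.2 e.1)

theorem evaluationScheme_isPrivate {h : Fin L → RatFunc F} {α : Fin N → F} (ht : 0 < t)
    (hα : Function.Injective α) : (evaluationScheme K x t h α).IsPrivate t := by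
  intro C hC s θ θ'
  have key : ((evaluationScheme K x t h α).query θ).map C.restrict
      = ((evaluationScheme K x t h α).query θ').map C.restrict := by
    have := map_restrict_uniform_shares_eq ht hα C hC
      (fun _ (_ : Fin L × Fin K) => (1 : F)) (fun _ _ => one_ne_zero)
      (fun n e => if e.2 = θ then valueAt (α n) (h e.1) else 0)
      (fun n e => if e.2 = θ' then valueAt (α n) (h e.1) else 0)
    simp only [one_mul] at this
    exact this
  -- Shares and queries are independent, so the view depends on the index only through the law of
  -- the restricted queries.
  have hview : ∀ θ, (evaluationScheme K x t h α).view C s θ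
      = ((evaluationScheme K x t h α).storage s).bind fun σ =>
        (((evaluationScheme K x t h α).query θ).map C.restrict).map (Prod.mk (C.restrict σ)) :=
    fun θ => by
      simp only [PIRScheme.view, PMF.map_comp]
      rfl
  rw [hview, hview, key]

theorem evaluationScheme_isCorrect (hL : 2 ∣ L) (hx : 0 < x) (ht : 0 < t)
    {f : Fin (L / 2) → F[X]} (hf : Function.Injective f)
    (hirr : ∀ a, (f a).Monic ∧ Irreducible (f a) ∧ (f a).natDegree = 2)
    {α : Fin (L + (x + t + 2)) → F} (hα : Function.Injective α) (hα0 : ∀ n, α n ≠ 0) :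
    (evaluationScheme K x t (queryFunction hL f) α).IsCorrect := by
  classical
  set S := evaluationScheme K x t (queryFunction hL f) α with hS
  have key : ∀ (s s' : Fin K → Fin L → F) (θ θ' : Fin K),
      ∀ σ ∈ (S.storage s).support, ∀ σ' ∈ (S.storage s').support,
      ∀ κ ∈ (S.query θ).support, ∀ κ' ∈ (S.query θ').support,
      (fun n => S.answer n (σ n) (κ n)) = (fun n => S.answer n (σ' n) (κ' n)) →
      s θ = s' θ' := by
    intro s s' θ θ' σ hσ σ' hσ' κ hκ κ' hκ' hans
    obtain ⟨r, -, rfl⟩ := (PMF.mem_support_map_iff _ _ _).1 hσ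
    obtain ⟨r', -, rfl⟩ := (PMF.mem_support_map_iff _ _ _).1 hσ'
    obtain ⟨z, -, rfl⟩ := (PMF.mem_support_map_iff _ _ _).1 hκ
    obtain ⟨z', -, rfl⟩ := (PMF.mem_support_map_iff _ _ _).1 hκ'
    obtain ⟨P, hP, hPe⟩ := exists_answer_eq hL hx ht f hirr s θ r z
    obtain ⟨P', hP', hPe'⟩ := exists_answer_eq hL hx ht f hirr s' θ' r' z'
    rw [← sub_eq_zero]
    refine eq_zero_of_sum_queryFunction_add_eval_eq_zero hL f hf hirr (by omega) hα
      (s θ - s' θ') (P - P') ((natDegree_sub_le _ _).trans_lt (max_lt hP hP')) fun n => ?_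
    have h1 := hPe (α n) (hα0 n)
    have h2 := hPe' (α n) (hα0 n)
    have h3 := congrArg (α n * ·) (congrFun (congrFun hans n) (0 : Fin 1))
    have h4 := h1.symm.trans (h3.trans h2)
    simp only [Pi.sub_apply, sub_mul, Finset.sum_sub_distrib, eval_sub]
    linear_combination h4
  -- By `key` the answers alone fix the desired message, even without the index. Answers that never
  -- occur decode to the default `0`.
  refine ⟨fun y => if hy : ∃ v, ∃ (s : Fin K → Fin L → F) (θ : Fin K),
      ∃ σ ∈ (S.storage s).support, ∃ κ ∈ (S.query θ).support,
        (fun n => S.answer n (σ n) (κ n)) = y ∧ s θ = v then hy.choose else 0, ?_⟩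
  intro s θ σ hσ κ hκ
  have hy : ∃ v, ∃ (s' : Fin K → Fin L → F) (θ' : Fin K),
      ∃ σ' ∈ (S.storage s').support, ∃ κ' ∈ (S.query θ').support,
        (fun n => S.answer n (σ' n) (κ' n)) = (fun n => S.answer n (σ n) (κ n)) ∧ s' θ' = v :=
    ⟨s θ, s, θ, σ, hσ, κ, hκ, rfl, rfl⟩
  refine (dif_pos hy).trans ?_
  obtain ⟨s', θ', σ', hσ', κ', hκ', hans, hv⟩ := hy.choose_spec
  rw [← hv]
  exact key s' s θ' θ σ' hσ' σ hσ κ' hκ' κ hκ hans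

theorem evaluationScheme_rate (h : Fin L → RatFunc F) (α : Fin N → F) :
    (evaluationScheme K x t h α).rate = (L : ℚ) / N := by
  have : ∑ n, (evaluationScheme K x t h α).answerLen n = N := by
    change ∑ _n : Fin N, 1 = N
    simp
  rw [PIRScheme.rate, this]

end EvaluationScheme

theorem mainTheorem2 {F : Type*} [Field F] [Fintype F] (q L X T : ℕ)
    (hF : Fintype.card F = q) (hL : 0 < L) (hX : 0 < X) (hT : 0 < T)
    (hLeven : 2 ∣ L) (hq : L + X + T + 3 ≤ q) :
    (∃ f : Fin (L / 2) → F[X], Function.Injective f ∧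
      ∀ a, (f a).Monic ∧ Irreducible (f a) ∧ (f a).natDegree = 2) ∧
    ∀ f : Fin (L / 2) → F[X], Function.Injective f →
      (∀ a, (f a).Monic ∧ Irreducible (f a) ∧ (f a).natDegree = 2) →
      ∃ α : Fin (L + X + T + 2) → F, Function.Injective α ∧ (∀ n, α n ≠ 0) ∧
        ∀ K : ℕ, ∃ S : PIRScheme F K L (L + X + T + 2),
          S = evaluationScheme K X T (queryFunction hLeven f) α ∧
          S.IsXSTPIR X T ∧
          S.rate = (L : ℚ) / ((L : ℚ) + X + T + 2) := by
  classical
  subst hF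
  refine ⟨exists_injective_monic_irreducible_quadratic F ?_, fun f hf hirr => ?_⟩
  · obtain ⟨k, hk⟩ := Nat.exists_eq_add_of_le' (show 2 ≤ Fintype.card F by omega)
    -- There are at least `q.choose 2` irreducible quadratics, and `L / 2 ≤ q - 1`.
    have h1 : Fintype.card F - 1 ≤ (Fintype.card F).choose 2 := by
      rw [hk, Nat.choose_succ_succ' _ 1, Nat.choose_one_right]
      omega
    omega
  · obtain ⟨g⟩ : Nonempty (Fin (L + X + T + 2) ↪ Fˣ) := by
      rw [Function.Embedding.nonempty_iff_card_le, Fintype.card_fin, Fintype.card_units]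
      omega
    have hα : Function.Injective fun n => (g n : F) := fun a b hab => g.injective (Units.ext hab)
    have hα0 : ∀ n, (g n : F) ≠ 0 := fun n => (g n).ne_zero
    refine ⟨fun n => g n, hα, hα0, fun K => ⟨_, rfl, ⟨by omega, hT, by omega, ?_, ?_, ?_⟩, ?_⟩⟩
    · have hcast : L + X + T + 2 = L + (X + T + 2) := by omega
      revert g hα hα0
      rw [hcast]
      exact fun g hα hα0 => evaluationScheme_isCorrect hLeven hX hT hf hirr hα hα0
    · refine evaluationScheme_isSecure hX hα fun n l => ?_
      rw [valueAt_queryFunction_inv hLeven f _ (hα0 n)]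
      exact div_ne_zero (eval_ne_zero_of_irreducible_of_one_lt_natDegree (hirr _).2.1
        (by rw [(hirr _).2.2]; omega) _) (pow_ne_zero _ (hα0 n))
    · exact evaluationScheme_isPrivate hT hα
    · rw [evaluationScheme_rate]
      push_cast
      rfl
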